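/- **Theorem (exact recursive integration of a class of rational functions).** Let $T=[v_0,v_1,v_2]\subset\mathbb R^2$ be a (nondegenerate) triangle with barycentric coordinates $\lambda=(\lambda_0,\lambda_1,\lambda_2)$. For $\alpha,\beta\in\mathbb N_0^3$ put $|\alpha|=\alpha_0+\alpha_1+\alpha_2$ and $$\mathcal I(\alpha,\beta)=\frac1{|T|}\int_T\frac{\prod_{j=0}^2\lambda_j^{\alpha_j}}{\prod_{j=0}^2(1-\lambda_j)^{\beta_j}}\,dx\in[0,\infty].$$ Let $\hat v_0=(1,0,0)$, $\hat v_1=(0,1,0)$, $\hat v_2=(0,0,1)$. Consider the following two recursive algorithms, carried out in exact arithmetic. *Algorithm* $\mathtt{ComputeJ}(\alpha_1,\alpha_2,\beta_1,\beta_2)$, for $\alpha_1,\alpha_2,\beta_1,\beta_2\in\mathbb N_0$: 1. If $\max\{\alpha_1+\beta_1,\alpha_2+\beta_2\}>\alpha_1+\alpha_2+1$, return $\infty$. 2. Otherwise sort the pairs $((\alpha_j,\beta_j))_{j=1,2}$ such that $\beta_1\le\beta_2$ (ties broken arbitrarily). 3. If $\beta_1=0$, return $\frac{2}{\alpha_1+1}\,\frac{\alpha_2!\,(\alpha_1-\beta_2+1)!}{(\alpha_1+\alpha_2-\beta_2+2)!}$.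 4. If $\beta_1=\beta_2=1$, return $-2\sum_{i=1}^{\alpha_2}\frac1{i^2}+\frac{\pi^2}{3}-2\sum_{j=1}^{\alpha_1}\frac1j\,\frac{\alpha_2!\,(j-1)!}{(\alpha_2+j)!}$. 5. If $\beta_1=1<\beta_2$, return $\frac{\beta_2-\alpha_2-2}{\beta_2-1}\,\mathtt{ComputeJ}(\alpha_1,\alpha_2,1,\beta_2-1)+\frac{2}{\beta_2-1}\,\frac{(\alpha_1-\beta_2+1)!\,\alpha_2!}{(\alpha_1-\beta_2+\alpha_2+2)!}$. 6. If $\beta_1>1$, return $\frac{\beta_1-\alpha_1-2}{\beta_1-1}\,\mathtt{ComputeJ}(\alpha_1,\alpha_2,\beta_1-1,\beta_2)+\frac{2}{\beta_1-1}\,\frac{(\alpha_2-\beta_1+1)!\,(\alpha_1-\beta_2+1)!}{(\alpha_2-\beta_1+\alpha_1-\beta_2+3)!}$. *Algorithm* $\mathtt{ComputeI}(\alpha,\beta)$, for $\alpha,\beta\in\mathbb N_0^3$ (each step applies only if no earlier step has returned a value): 1. If $\max_{j}(\alpha_j+\beta_j)>|\alpha|+1$, return $\infty$. 2. Sort the pairs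 $((\alpha_j,\beta_j))_{j=0,1,2}$ such that $\beta_0\le\beta_1\le\beta_2$ (ties broken arbitrarily). 3. If $\beta_0=\beta_1=0$, return $2\,\frac{\alpha_0!\,\alpha_1!\,\alpha_2!}{(|\alpha|-\beta_2+2)!}\,\frac{(\alpha_0+\alpha_1+1-\beta_2)!}{(\alpha_0+\alpha_1+1)!}$. 4. If $\beta_0\ge1$, return $\frac12\sum_{j=0}^2\mathtt{ComputeI}(\alpha,\beta-\hat v_j)$. 5. If $\alpha_0=0$, return $\mathtt{ComputeJ}(\alpha_1,\alpha_2,\beta_1,\beta_2)$. 6. If $\alpha_1+\beta_1<|\alpha|+1$, return $\mathtt{ComputeI}(\alpha-\hat v_0,\beta-\hat v_2)-\mathtt{ComputeI}(\alpha-\hat v_0+\hat v_1,\beta)$. 7. If $\alpha_2+\beta_2<|\alpha|+1$, return $\mathtt{ComputeI}(\alpha-\hat v_0,\beta-\hat v_1)-\mathtt{ComputeI}(\alpha-\hat v_0+\hat v_2,\beta)$. 8. Otherwise return $\frac12\sum_{j=1}^2\big(\mathtt{ComputeI}(\alpha,\beta-\hat v_j)+\mathtt{ComputeI}(\alpha-\hat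 v_0+\hat v_j,\beta-\hat v_j)\big)-\mathtt{ComputeI}(\alpha-\hat v_0+\hat v_1+\hat v_2,\beta)$. Then for all $\alpha,\beta\in\mathbb N_0^3$ the algorithm $\mathtt{ComputeI}(\alpha,\beta)$ terminates and returns $\mathcal I(\alpha,\beta)$. In particular it returns $\infty$ if and only if the integral diverges, that is, if and only if $\lambda^\alpha/(1-\lambda)^\beta$ is not integrable over $T$. -/

import Mathlib

open MeasureTheory
open scoped Nat ENNReal

/-- The rational function `λ ↦ λ^α / (1 - λ)^β = ∏ⱼ λⱼ^αⱼ / ∏ⱼ (1 - λⱼ)^βⱼ` for `α, β ∈ ℕ₀³`. -/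
noncomputable def ratFun (α β : Fin 3 → ℕ) (l : Fin 3 → ℝ) : ℝ :=
  (∏ j, l j ^ α j) / ∏ j, (1 - l j) ^ β j

/-- The closed nondegenerate triangle `[v₀, v₁, v₂]` in the plane. An affine basis indexed by `Fin 3`
is the same as three affinely independent points; its coordinate functions `T.coord j` are the
barycentric coordinates. -/
def triangleSet (T : AffineBasis (Fin 3) ℝ (EuclideanSpace ℝ (Fin 2))) :
    Set (EuclideanSpace ℝ (Fin 2)) :=
  convexHull ℝ (Set.range T)

/-- The function `x ↦ λ(x)^α / (1 - λ(x))^β`, with `λ(x)` the barycentric coordinates of `x`.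
(The denominator vanishes on the triangle at most in the three vertices, a null set.) -/
noncomputable def ratFunOn (T : AffineBasis (Fin 3) ℝ (EuclideanSpace ℝ (Fin 2)))
    (α β : Fin 3 → ℕ) (x : EuclideanSpace ℝ (Fin 2)) : ℝ :=
  ratFun α β (fun j => T.coord j x)

/-- The mean integral `I(α, β) ∈ [0, ∞]` of the nonnegative function `λ^α / (1 - λ)^β` over the
triangle; it is `∞` if the integral diverges. -/
noncomputable def meanIntegral (T : AffineBasis (Fin 3) ℝ (EuclideanSpace ℝ (Fin 2)))
    (α β : Fin 3 → ℕ) : ℝ≥0∞ :=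
  ⨍⁻ x in triangleSet T, ENNReal.ofReal (ratFunOn T α β x) ∂volume

/-- A sorting routine for families of pairs `((αⱼ, βⱼ))ⱼ`: it picks a permutation that makes the
second entries nondecreasing. Ties may be broken in any way. -/
structure SortRule (n : ℕ) where
  perm : (Fin n → ℕ) → (Fin n → ℕ) → Equiv.Perm (Fin n)
  sorted : ∀ α β, Monotone (β ∘ perm α β)

instance (n : ℕ) : Nonempty (SortRule n) :=
  ⟨⟨fun _ β => Tuple.sort β, fun _ β => Tuple.monotone_sort β⟩⟩

/-- `ComputeJ(α₁, α₂, β₁, β₂)`, run with recursion depth at most the first argument; `none` means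
that the run did not finish within that depth. Values are extended reals and the arithmetic is exact.
`a₁, a₂, b₁, b₂` is the input before sorting, `α₁, α₂, β₁, β₂` the input after sorting.
All natural number subtractions are genuine: the first test guarantees
`β₁ ≤ α₂ + 1` and `β₂ ≤ α₁ + 1`. -/
noncomputable def computeJ (s : SortRule 2) : ℕ → ℕ → ℕ → ℕ → ℕ → Option EReal
  | 0, _, _, _, _ => none
  | depth + 1, a₁, a₂, b₁, b₂ =>
    if max (a₁ + b₁) (a₂ + b₂) > a₁ + a₂ + 1 then some ⊤
    else
      let σ := s.perm ![a₁, a₂] ![b₁, b₂]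
      let α₁ := ![a₁, a₂] (σ 0)
      let α₂ := ![a₁, a₂] (σ 1)
      let β₁ := ![b₁, b₂] (σ 0)
      let β₂ := ![b₁, b₂] (σ 1)
      if β₁ = 0 then
        some ((2 / ((α₁ : ℝ) + 1) *
          (((α₂ ! : ℕ) : ℝ) * (((α₁ + 1 - β₂)! : ℕ) : ℝ) / (((α₁ + α₂ + 2 - β₂)! : ℕ) : ℝ)) : ℝ) :
            EReal)
      else if β₁ = 1 then
        if β₂ = 1 then
          some ((-2 * ∑ i ∈ Finset.Icc 1 α₂, 1 / (i : ℝ) ^ 2 + Real.pi ^ 2 / 3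
            - 2 * ∑ j ∈ Finset.Icc 1 α₁, 1 / (j : ℝ) *
              (((α₂ ! : ℕ) : ℝ) * (((j - 1)! : ℕ) : ℝ) / (((α₂ + j)! : ℕ) : ℝ)) : ℝ) : EReal)
        else do
          let r ← computeJ s depth α₁ α₂ 1 (β₂ - 1)
          return (((((β₂ : ℝ) - α₂ - 2) / ((β₂ : ℝ) - 1) : ℝ) : EReal) * r +
            ((2 / ((β₂ : ℝ) - 1) *
              ((((α₁ + 1 - β₂)! : ℕ) : ℝ) * ((α₂ ! : ℕ) : ℝ) /
                (((α₁ + α₂ + 2 - β₂)! : ℕ) : ℝ)) : ℝ) : EReal))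
      else do
        let r ← computeJ s depth α₁ α₂ (β₁ - 1) β₂
        return (((((β₁ : ℝ) - α₁ - 2) / ((β₁ : ℝ) - 1) : ℝ) : EReal) * r +
          ((2 / ((β₁ : ℝ) - 1) *
            ((((α₂ + 1 - β₁)! : ℕ) : ℝ) * (((α₁ + 1 - β₂)! : ℕ) : ℝ) /
              (((α₁ + α₂ + 3 - (β₁ + β₂))! : ℕ) : ℝ)) : ℝ) : EReal))

/-- The unit multi-index `v̂ⱼ`. -/
def unitIdx (j : Fin 3) : Fin 3 → ℕ := Pi.single j 1

/-- `ComputeI(α, β)`, run with recursion depth at most the natural number argument; `none` means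
that the run did not finish within that depth. Values are extended reals and the arithmetic is exact.
`a, b` is the input before sorting, `α, β` the input after sorting.
All natural number subtractions are genuine: the first test guarantees `β 2 ≤ α 0 + α 1 + 1`, and
the tests before each recursive call guarantee that the entries which are lowered are positive. -/
noncomputable def computeI (s₂ : SortRule 2) (s₃ : SortRule 3) :
    ℕ → (Fin 3 → ℕ) → (Fin 3 → ℕ) → Option EReal
  | 0, _, _ => none
  | depth + 1, a, b =>
    if max (a 0 + b 0) (max (a 1 + b 1) (a 2 + b 2)) > a 0 + a 1 + a 2 + 1 then some ⊤
    else
      let σ := s₃.perm a b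
      let α : Fin 3 → ℕ := fun j => a (σ j)
      let β : Fin 3 → ℕ := fun j => b (σ j)
      if β 0 = 0 ∧ β 1 = 0 then
        some ((2 * ((((α 0)! : ℕ) : ℝ) * (((α 1)! : ℕ) : ℝ) * (((α 2)! : ℕ) : ℝ) /
            (((α 0 + α 1 + α 2 + 2 - β 2)! : ℕ) : ℝ)) *
          ((((α 0 + α 1 + 1 - β 2)! : ℕ) : ℝ) / (((α 0 + α 1 + 1)! : ℕ) : ℝ)) : ℝ) : EReal)
      else if 1 ≤ β 0 then do
        let r₀ ← computeI s₂ s₃ depth α (β - unitIdx 0)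
        let r₁ ← computeI s₂ s₃ depth α (β - unitIdx 1)
        let r₂ ← computeI s₂ s₃ depth α (β - unitIdx 2)
        return ((1 / 2 : ℝ) : EReal) * (r₀ + r₁ + r₂)
      else if α 0 = 0 then
        computeJ s₂ depth (α 1) (α 2) (β 1) (β 2)
      else if α 1 + β 1 < α 0 + α 1 + α 2 + 1 then do
        let r ← computeI s₂ s₃ depth (α - unitIdx 0) (β - unitIdx 2)
        let r' ← computeI s₂ s₃ depth (α - unitIdx 0 + unitIdx 1) β
        return r - r'
      else if α 2 + β 2 < α 0 + α 1 + α 2 + 1 then do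
        let r ← computeI s₂ s₃ depth (α - unitIdx 0) (β - unitIdx 1)
        let r' ← computeI s₂ s₃ depth (α - unitIdx 0 + unitIdx 2) β
        return r - r'
      else do
        let r₁ ← computeI s₂ s₃ depth α (β - unitIdx 1)
        let r₁' ← computeI s₂ s₃ depth (α - unitIdx 0 + unitIdx 1) (β - unitIdx 1)
        let r₂ ← computeI s₂ s₃ depth α (β - unitIdx 2)
        let r₂' ← computeI s₂ s₃ depth (α - unitIdx 0 + unitIdx 2) (β - unitIdx 2)
        let q ← computeI s₂ s₃ depth (α - unitIdx 0 + unitIdx 1 + unitIdx 2) β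
        return ((1 / 2 : ℝ) : EReal) * ((r₁ + r₁') + (r₂ + r₂')) - q

/-! An affine change of variables turns the mean over `T` into twice the integral over the standard
simplex, with barycentric coordinates `(1 - x - y, x, y)` (`meanIntegral_eq`). The integral is
finite exactly when `α j + β j ≤ |α| + 1` for all `j`. With a single denominator the fibre integral
is an Euler integral, leaving a power of `1 - x` whose exponent decides convergence. In general at
most one `1 - λ j` is below `1 / 2`, so the denominators interact only up to constants
(`Admissible.stdLint_ne_top`, `stdLint_eq_top_of_not_admissible`).

In the convergent range each recursive step of `computeI` integrates a pointwise identity derived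
from `∑ λ j = 1`: `stdMean_of_one_le`, `stdMean_eq_sub`, `stdMean_eq_half_add_sub`. When `α 0 = β 0
= 0`, integrating an exact `y`-derivative gives the recursion of `computeJ`
(`stdMean_pair_recursion`), whose base case comes from `∑ 1 / i ^ 2 = π ^ 2 / 6`
(`stdMean_pair_one`).

Each recursive call stays in the convergent range, so `∞` never enters the arithmetic. Termination
is lexicographic: either `|β|` drops, or `β` is kept and the sum of the `α j` with `β j = 0` drops.
Both quantities are invariant under permutation, so the choice of sorting is immaterial. -/

/-! ### Euler beta integrals. -/

/-- The value `m! n! / (m + n + 1)!` of the Euler beta integral at natural numbers. -/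
noncomputable def betaFrac (m n : ℕ) : ℝ := (m ! : ℝ) * (n ! : ℝ) / ((m + n + 1)! : ℝ)

lemma betaFrac_pos (m n : ℕ) : 0 < betaFrac m n := by
  unfold betaFrac; positivity

/-- Integration by parts: `(t - y) ^ (m + 1) * y ^ (n + 1)` vanishes at both ends, which trades a
power of `t - y` for a power of `y`. -/
lemma intervalIntegral_sub_pow_mul_pow (t : ℝ) (m n : ℕ) :
    ∫ y in (0 : ℝ)..t, (t - y) ^ m * y ^ n = betaFrac m n * t ^ (m + n + 1) := by
  induction m generalizing n with
  | zero =>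
    simp only [pow_zero, one_mul, integral_pow, betaFrac, Nat.factorial_zero, zero_add,
      Nat.factorial_succ]
    have : ((n ! : ℕ) : ℝ) ≠ 0 := by positivity
    have h2 : (n : ℝ) + 1 ≠ 0 := by positivity
    push_cast
    field_simp
    simp
  | succ m ih =>
    have key : ∫ y in (0 : ℝ)..t, (((n : ℝ) + 1) * ((t - y) ^ (m + 1) * y ^ n)
        - ((m : ℝ) + 1) * ((t - y) ^ m * y ^ (n + 1))) = 0 := by
      have hd : ∀ y ∈ Set.uIcc 0 t, HasDerivAt (fun y : ℝ => (t - y) ^ (m + 1) * y ^ (n + 1))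
          (((n : ℝ) + 1) * ((t - y) ^ (m + 1) * y ^ n)
            - ((m : ℝ) + 1) * ((t - y) ^ m * y ^ (n + 1))) y := by
        intro y _
        have h1 : HasDerivAt (fun y : ℝ => (t - y) ^ (m + 1))
            (((m + 1 : ℕ) : ℝ) * (t - y) ^ m * (-1)) y := by
          simpa using ((hasDerivAt_id y).const_sub t).fun_pow (m + 1)
        have h2 : HasDerivAt (fun y : ℝ => y ^ (n + 1)) (((n + 1 : ℕ) : ℝ) * y ^ n) y := by
          simpa using hasDerivAt_pow (n + 1) y
        refine (h1.mul h2).congr_deriv ?_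
        push_cast; ring
      rw [intervalIntegral.integral_eq_sub_of_hasDerivAt hd
        (Continuous.intervalIntegrable (by fun_prop) _ _)]
      simp
    rw [intervalIntegral.integral_sub (Continuous.intervalIntegrable (by fun_prop) _ _)
      (Continuous.intervalIntegrable (by fun_prop) _ _), intervalIntegral.integral_const_mul,
      intervalIntegral.integral_const_mul, ih (n + 1)] at key
    have h1 : (n : ℝ) + 1 ≠ 0 := by positivity
    apply mul_left_cancel₀ h1
    rw [sub_eq_zero.1 key]
    simp only [betaFrac]
    rw [show m + (n + 1) + 1 = m + 1 + n + 1 by ring, Nat.factorial_succ m, Nat.factorial_succ n]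
    push_cast
    ring

lemma integral_pow_mul_one_sub_pow (m n : ℕ) :
    ∫ x in Set.Ioo (0 : ℝ) 1, x ^ m * (1 - x) ^ n = betaFrac m n := by
  rw [← integral_Ioc_eq_integral_Ioo, ← intervalIntegral.integral_of_le zero_le_one]
  have := intervalIntegral_sub_pow_mul_pow 1 n m
  simp only [one_pow, mul_one] at this
  rw [show betaFrac m n = betaFrac n m by simp only [betaFrac]; rw [add_comm m n]; ring, ← this]
  exact intervalIntegral.integral_congr fun x _ => mul_comm _ _

lemma lintegral_pow_mul_one_sub_pow {C : ℝ} (hC : 0 ≤ C) (m n : ℕ) :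
    ∫⁻ x in Set.Ioo (0 : ℝ) 1, ENNReal.ofReal (C * (x ^ m * (1 - x) ^ n)) =
      ENNReal.ofReal (C * betaFrac m n) := by
  rw [← integral_pow_mul_one_sub_pow, ← integral_const_mul, ofReal_integral_eq_lintegral_ofReal]
  · exact (Continuous.integrableOn_Icc (by fun_prop)).mono_set Set.Ioo_subset_Icc_self
  · filter_upwards [ae_restrict_mem measurableSet_Ioo] with x hx
    have := hx.1; have := sub_pos.2 hx.2
    simp only [Pi.zero_apply]
    positivity

/-! ### Integration over the standard simplex. -/

/-- The open standard simplex in the plane. -/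
def stdSimplex2 : Set (ℝ × ℝ) := {p | 0 < p.1 ∧ 0 < p.2 ∧ p.1 + p.2 < 1}

lemma measurableSet_stdSimplex2 : MeasurableSet stdSimplex2 := by
  refine MeasurableSet.inter (measurableSet_lt measurable_const measurable_fst)
    (MeasurableSet.inter (measurableSet_lt measurable_const measurable_snd)
      (measurableSet_lt (measurable_fst.add measurable_snd) measurable_const))

lemma lintegral_stdSimplex2 {f : ℝ × ℝ → ℝ≥0∞} (hf : Measurable f) :
    ∫⁻ p in stdSimplex2, f p =
      ∫⁻ x in Set.Ioo (0 : ℝ) 1, ∫⁻ y in Set.Ioo 0 (1 - x), f (x, y) := by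
  rw [← lintegral_indicator measurableSet_stdSimplex2, Measure.volume_eq_prod,
    lintegral_prod _ (hf.indicator measurableSet_stdSimplex2).aemeasurable,
    ← lintegral_indicator measurableSet_Ioo]
  refine lintegral_congr fun x => ?_
  by_cases hx : x ∈ Set.Ioo (0 : ℝ) 1
  · rw [Set.indicator_of_mem hx, ← lintegral_indicator measurableSet_Ioo]
    refine lintegral_congr fun y => ?_
    simp only [Set.indicator]
    congr 1
    simp only [stdSimplex2, Set.mem_ofPred_eq, Set.mem_Ioo, hx.1, true_and, eq_iff_iff]
    constructor <;> rintro ⟨h1, h2⟩ <;> exact ⟨h1, by linarith⟩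
  · rw [Set.indicator_of_notMem hx]
    rw [lintegral_eq_zero_iff' ]
    · refine Filter.Eventually.of_forall fun y => ?_
      refine Set.indicator_of_notMem ?_ _
      rintro ⟨h1, h2, h3⟩
      exact hx ⟨h1, by simp only at h2 h3; linarith⟩
    · exact ((hf.indicator measurableSet_stdSimplex2).comp measurable_prodMk_left).aemeasurable

/-- Tonelli for nonnegative integrands: the inner integral may be evaluated by the fundamental
theorem of calculus, with no prior knowledge of integrability in the plane. -/
lemma lintegral_stdSimplex2_of_fiber {f : ℝ × ℝ → ℝ} (hf : Measurable f)
    (h0 : ∀ p ∈ stdSimplex2, 0 ≤ f p) {h : ℝ → ℝ}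
    (hint : ∀ x ∈ Set.Ioo (0 : ℝ) 1, IntervalIntegrable (fun y => f (x, y)) volume 0 (1 - x))
    (hval : ∀ x ∈ Set.Ioo (0 : ℝ) 1, ∫ y in (0 : ℝ)..(1 - x), f (x, y) = h x) :
    ∫⁻ p in stdSimplex2, ENNReal.ofReal (f p) =
      ∫⁻ x in Set.Ioo (0 : ℝ) 1, ENNReal.ofReal (h x) := by
  rw [lintegral_stdSimplex2 hf.ennreal_ofReal]
  refine setLIntegral_congr_fun measurableSet_Ioo fun x hx => ?_
  have hle : (0 : ℝ) ≤ 1 - x := by linarith [hx.2]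
  rw [← hval x hx, intervalIntegral.integral_of_le hle, integral_Ioc_eq_integral_Ioo,
    ofReal_integral_eq_lintegral_ofReal]
  · exact ((intervalIntegrable_iff_integrableOn_Ioo_of_le hle).1 (hint x hx))
  · filter_upwards [ae_restrict_mem measurableSet_Ioo] with y hy
    exact h0 _ ⟨hx.1, hy.1, by have := hy.2; simp only; linarith⟩

/-- The rational function `λ ^ α / (1 - λ) ^ β` on the standard simplex, with barycentric
coordinates `(1 - x - y, x, y)`. -/
noncomputable def stdRatFun (α β : Fin 3 → ℕ) (p : ℝ × ℝ) : ℝ :=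
  ratFun α β ![1 - p.1 - p.2, p.1, p.2]

lemma stdRatFun_eq (α β : Fin 3 → ℕ) (p : ℝ × ℝ) :
    stdRatFun α β p = ((1 - p.1 - p.2) ^ α 0 * p.1 ^ α 1 * p.2 ^ α 2) /
      ((p.1 + p.2) ^ β 0 * (1 - p.1) ^ β 1 * (1 - p.2) ^ β 2) := by
  simp only [stdRatFun, ratFun, Fin.prod_univ_three, Matrix.cons_val_zero, Matrix.cons_val_one,
    Matrix.cons_val]
  ring_nf

lemma measurable_stdRatFun (α β : Fin 3 → ℕ) : Measurable (stdRatFun α β) := by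
  have : stdRatFun α β = _ := funext (stdRatFun_eq α β)
  rw [this]
  fun_prop

lemma stdRatFun_nonneg (α β : Fin 3 → ℕ) {p : ℝ × ℝ} (hp : p ∈ stdSimplex2) :
    0 ≤ stdRatFun α β p := by
  obtain ⟨h1, h2, h3⟩ := hp
  have h4 : 0 < 1 - p.1 - p.2 := by linarith
  have h5 : 0 < 1 - p.1 := by linarith
  have h6 : 0 < 1 - p.2 := by linarith
  rw [stdRatFun_eq]
  positivity

/-! ### A single denominator, and divergence. -/

/-- The integral of `λ ^ α / (1 - λ) ^ β` over the standard simplex, in `[0, ∞]`. -/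
noncomputable def stdLint (α β : Fin 3 → ℕ) : ℝ≥0∞ :=
  ∫⁻ p in stdSimplex2, ENNReal.ofReal (stdRatFun α β p)

lemma stdLint_eq_of_single (α : Fin 3 → ℕ) (k : ℕ) :
    stdLint α ![0, k, 0] = ∫⁻ x in Set.Ioo (0 : ℝ) 1,
      ENNReal.ofReal (betaFrac (α 0) (α 2) * (x ^ α 1 * (1 - x) ^ (α 0 + α 2 + 1) / (1 - x) ^ k)) := by
  have hf (p : ℝ × ℝ) : stdRatFun α ![0, k, 0] p =
      p.1 ^ α 1 / (1 - p.1) ^ k * ((1 - p.1 - p.2) ^ α 0 * p.2 ^ α 2) := by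
    rw [stdRatFun_eq]
    simp
    ring
  refine lintegral_stdSimplex2_of_fiber (measurable_stdRatFun _ _)
    (fun p hp => stdRatFun_nonneg _ _ hp) (fun x _ => ?_) (fun x _ => ?_)
  · simp only [hf]
    exact Continuous.intervalIntegrable (by fun_prop) _ _
  · simp only [hf]
    rw [intervalIntegral.integral_const_mul, intervalIntegral_sub_pow_mul_pow]
    ring

lemma stdLint_single (α : Fin 3 → ℕ) (k : ℕ) (hk : k ≤ α 0 + α 2 + 1) :
    stdLint α ![0, k, 0] =
      ENNReal.ofReal (betaFrac (α 0) (α 2) * betaFrac (α 1) (α 0 + α 2 + 1 - k)) := by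
  rw [stdLint_eq_of_single, ← lintegral_pow_mul_one_sub_pow (betaFrac_pos _ _).le]
  refine setLIntegral_congr_fun measurableSet_Ioo fun x hx => ?_
  have : (1 - x) ≠ 0 := (sub_pos.2 hx.2).ne'
  rw [pow_sub₀ _ this hk]
  ring_nf

/-- The other denominators are at most `1` and can be dropped. The fibre integral then leaves `(1 -
x)` to a power at most `-1`, which is not integrable at `x = 1`. -/
lemma stdLint_eq_top (α β : Fin 3 → ℕ) (h : α 0 + α 2 + 2 ≤ β 1) : stdLint α β = ⊤ := by
  have hle : stdLint α ![0, β 1, 0] ≤ stdLint α β := by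
    refine setLIntegral_mono' measurableSet_stdSimplex2 fun p hp => ENNReal.ofReal_le_ofReal ?_
    obtain ⟨h1, h2, h3⟩ := hp
    have h4 : 0 < 1 - p.1 - p.2 := by linarith
    have h5 : 0 < 1 - p.1 := by linarith
    have h6 : 0 < 1 - p.2 := by linarith
    have h7 : 0 < p.1 + p.2 := by linarith
    rw [stdRatFun_eq, stdRatFun_eq]
    refine div_le_div_of_nonneg_left (by positivity) (by positivity) ?_
    simp only [Matrix.cons_val_zero, Matrix.cons_val_one, Matrix.cons_val, pow_zero, one_mul,
      mul_one]
    calc (p.1 + p.2) ^ β 0 * (1 - p.1) ^ β 1 * (1 - p.2) ^ β 2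
        ≤ 1 * (1 - p.1) ^ β 1 * 1 := by
          gcongr
          · exact pow_le_one₀ h7.le h3.le
          · exact pow_le_one₀ h6.le (by linarith)
      _ = _ := by ring
  rw [← top_le_iff]
  refine le_trans ?_ hle
  rw [stdLint_eq_of_single]
  -- On `(1/2, 1)` the factor `x ^ α 1` is at least `(1 / 2) ^ α 1`, so `C / (1 - x)` is a lower
  -- bound there.
  set C := betaFrac (α 0) (α 2) * (1 / 2) ^ α 1 with hC
  have hCpos : 0 < C := mul_pos (betaFrac_pos _ _) (by positivity)
  have hinf : ∫⁻ x in Set.Ioo (1 / 2 : ℝ) 1, ENNReal.ofReal (C * (1 - x)⁻¹) = ⊤ := by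
    by_contra hne
    have hnn : 0 ≤ᵐ[volume.restrict (Set.Ioo (1 / 2 : ℝ) 1)] fun x => C * (1 - x)⁻¹ := by
      filter_upwards [ae_restrict_mem measurableSet_Ioo] with x hx
      have := sub_pos.2 hx.2
      simp only [Pi.zero_apply]; positivity
    have hint : IntegrableOn (fun x : ℝ => C * (1 - x)⁻¹) (Set.Ioo (1 / 2) 1) := by
      refine ⟨(by fun_prop : Measurable _).aestronglyMeasurable, ?_⟩
      rw [hasFiniteIntegral_iff_ofReal hnn]
      exact lt_top_iff_ne_top.2 hne
    have h2 : IntervalIntegrable (fun x : ℝ => (x - 1)⁻¹) volume (1 / 2) 1 := by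
      rw [intervalIntegrable_iff_integrableOn_Ioo_of_le (by norm_num)]
      have := hint.const_mul (-C⁻¹)
      refine this.congr (Filter.Eventually.of_forall fun x => ?_)
      simp only
      rw [← neg_sub x 1, inv_neg]
      field_simp
    rw [intervalIntegrable_sub_inv_iff] at h2
    rcases h2 with h2 | h2
    · norm_num at h2
    · exact h2 (by rw [Set.uIcc_of_le (by norm_num)]; constructor <;> norm_num)
  rw [← hinf]
  refine le_trans ?_ (lintegral_mono_set (Set.Ioo_subset_Ioo_left (by norm_num : (0 : ℝ) ≤ 1 / 2)))
  refine setLIntegral_mono' measurableSet_Ioo fun x hx => ENNReal.ofReal_le_ofReal ?_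
  have h1 := sub_pos.2 hx.2
  have h2 : (1 : ℝ) / 2 ≤ x := hx.1.le
  rw [hC, mul_assoc]
  refine mul_le_mul_of_nonneg_left ?_ (betaFrac_pos _ _).le
  rw [mul_div_assoc]
  have h3 : (1 - x)⁻¹ ≤ (1 - x) ^ (α 0 + α 2 + 1) / (1 - x) ^ β 1 := by
    rw [inv_eq_one_div, div_le_div_iff₀ h1 (by positivity), one_mul, ← pow_succ]
    exact pow_le_pow_of_le_one h1.le (by linarith) h
  gcongr

/-! ### Transfer from the triangle to the standard simplex. -/

/-- Uniqueness of Haar measure. The constant need not be known, since it cancels in the mean. -/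
lemma AffineBasis.exists_map_coord_eq_smul (T : AffineBasis (Fin 3) ℝ (EuclideanSpace ℝ (Fin 2))) :
    ∃ c : ℝ≥0∞, c ≠ 0 ∧ c ≠ ⊤ ∧
      Measure.map (fun x => (T.coord 1 x, T.coord 2 x)) volume = c • (volume : Measure (ℝ × ℝ)) := by
  let L : EuclideanSpace ℝ (Fin 2) →ₗ[ℝ] ℝ × ℝ := (T.coord 1).linear.prod (T.coord 2).linear
  have hL : Function.Injective L := by
    rw [injective_iff_map_eq_zero]
    intro v hv
    have h1 : (T.coord 1).linear v = 0 := congrArg Prod.fst hv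
    have h2 : (T.coord 2).linear v = 0 := congrArg Prod.snd hv
    have e1 : T.coord 1 (v +ᵥ T 0) = T.coord 1 (T 0) := by rw [AffineMap.map_vadd, h1, zero_vadd]
    have e2 : T.coord 2 (v +ᵥ T 0) = T.coord 2 (T 0) := by rw [AffineMap.map_vadd, h2, zero_vadd]
    have s1 := T.sum_coord_apply_eq_one (v +ᵥ T 0)
    have s2 := T.sum_coord_apply_eq_one (T 0)
    rw [Fin.sum_univ_three] at s1 s2
    have : v +ᵥ T 0 = T 0 := T.ext_elem fun i => by
      fin_cases i
      · simp only [Fin.zero_eta]; linarith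
      · exact e1
      · exact e2
    simpa using this
  let e : EuclideanSpace ℝ (Fin 2) ≃L[ℝ] ℝ × ℝ :=
    (LinearEquiv.ofInjectiveOfFinrankEq L hL (by simp)).toContinuousLinearEquiv
  have he : (fun x => (T.coord 1 x, T.coord 2 x)) =
      (fun p => p + (T.coord 1 0, T.coord 2 0)) ∘ e := by
    funext x
    have hx (i : Fin 3) : T.coord i x = (T.coord i).linear x + T.coord i 0 := by
      conv_lhs => rw [← add_zero x, ← vadd_eq_add, AffineMap.map_vadd, vadd_eq_add]
    rw [hx 1, hx 2]
    rfl
  refine ⟨(Measure.map e volume).addHaarScalarFactor volume, ?_, ENNReal.coe_ne_top, ?_⟩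
  · rw [ne_eq, ENNReal.coe_eq_zero]
    exact (Measure.addHaarScalarFactor_pos_of_isAddHaarMeasure _ _).ne'
  · rw [he, ← Measure.map_map (by fun_prop) (by fun_prop), map_add_right_eq_self]
    exact Measure.isAddLeftInvariant_eq_smul _ _

/-- The preimage is the interior of the triangle, and a convex set has null frontier. -/
lemma volume_restrict_triangleSet (T : AffineBasis (Fin 3) ℝ (EuclideanSpace ℝ (Fin 2))) :
    volume.restrict (triangleSet T) = volume.restrict
      ((fun x => (T.coord 1 x, T.coord 2 x)) ⁻¹' stdSimplex2) := by
  have : (fun x => (T.coord 1 x, T.coord 2 x)) ⁻¹' stdSimplex2 = interior (triangleSet T) := by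
    rw [triangleSet, T.interior_convexHull]
    ext x
    have s1 := T.sum_coord_apply_eq_one x
    rw [Fin.sum_univ_three] at s1
    simp only [stdSimplex2, Set.mem_preimage, Set.mem_ofPred_eq, Fin.forall_fin_succ]
    simp
    constructor
    · rintro ⟨h1, h2, h3⟩; exact ⟨by linarith, h1, h2⟩
    · rintro ⟨h1, h2, h3⟩; exact ⟨h2, h3, by linarith⟩
  rw [this]
  refine Measure.restrict_congr_set ?_
  exact (interior_ae_eq_of_null_frontier ((convex_convexHull ℝ _).addHaar_frontier volume)).symm

lemma ratFunOn_eq_stdRatFun (T : AffineBasis (Fin 3) ℝ (EuclideanSpace ℝ (Fin 2)))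
    (α β : Fin 3 → ℕ) (x : EuclideanSpace ℝ (Fin 2)) :
    ratFunOn T α β x = stdRatFun α β (T.coord 1 x, T.coord 2 x) := by
  have s1 := T.sum_coord_apply_eq_one x
  rw [Fin.sum_univ_three] at s1
  rw [ratFunOn, stdRatFun]
  congr 1
  funext j
  fin_cases j
  · simp; linarith
  · simp
  · simp

lemma exists_lintegral_triangleSet (T : AffineBasis (Fin 3) ℝ (EuclideanSpace ℝ (Fin 2))) :
    ∃ c : ℝ≥0∞, c ≠ 0 ∧ c ≠ ⊤ ∧ ∀ α β : Fin 3 → ℕ,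
      ∫⁻ x in triangleSet T, ENNReal.ofReal (ratFunOn T α β x) = c * stdLint α β := by
  obtain ⟨c, h0, ht, hc⟩ := T.exists_map_coord_eq_smul
  have hm : Measurable fun x => (T.coord 1 x, T.coord 2 x) :=
    ((AffineMap.continuous_of_finiteDimensional _).prodMk
      (AffineMap.continuous_of_finiteDimensional _)).measurable
  refine ⟨c, h0, ht, fun α β => ?_⟩
  rw [volume_restrict_triangleSet]
  simp only [ratFunOn_eq_stdRatFun]
  rw [← setLIntegral_map measurableSet_stdSimplex2
    (measurable_stdRatFun α β).ennreal_ofReal hm, hc, Measure.restrict_smul, lintegral_smul_measure]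
  rfl

lemma stdLint_zero : stdLint 0 0 = ENNReal.ofReal (1 / 2) := by
  have : (0 : Fin 3 → ℕ) = ![0, 0, 0] := by ext i; fin_cases i <;> rfl
  conv_lhs => rw [this]
  rw [stdLint_single _ _ (by simp)]
  simp [betaFrac]

lemma meanIntegral_eq (T : AffineBasis (Fin 3) ℝ (EuclideanSpace ℝ (Fin 2))) (α β : Fin 3 → ℕ) :
    meanIntegral T α β = 2 * stdLint α β := by
  obtain ⟨c, h0, ht, hc⟩ := exists_lintegral_triangleSet T
  have hv : volume (triangleSet T) = c * ENNReal.ofReal (1 / 2) := by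
    rw [← stdLint_zero, ← hc]
    simp [ratFunOn, ratFun]
  rw [meanIntegral, setLAverage_eq, hc, hv, ENNReal.mul_div_mul_left _ _ h0 ht, div_eq_mul_inv,
    ← ENNReal.ofReal_inv_of_pos (by norm_num), mul_comm]
  norm_num

lemma integrableOn_ratFunOn_iff (T : AffineBasis (Fin 3) ℝ (EuclideanSpace ℝ (Fin 2)))
    (α β : Fin 3 → ℕ) :
    IntegrableOn (ratFunOn T α β) (triangleSet T) volume ↔ stdLint α β ≠ ⊤ := by
  obtain ⟨c, h0, ht, hc⟩ := exists_lintegral_triangleSet T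
  have hm : Measurable (ratFunOn T α β) := by
    have : ratFunOn T α β = stdRatFun α β ∘ fun x => (T.coord 1 x, T.coord 2 x) :=
      funext (ratFunOn_eq_stdRatFun T α β)
    rw [this]
    exact (measurable_stdRatFun α β).comp ((AffineMap.continuous_of_finiteDimensional _).prodMk
      (AffineMap.continuous_of_finiteDimensional _)).measurable
  have hnn : 0 ≤ᵐ[volume.restrict (triangleSet T)] ratFunOn T α β := by
    have hmem : ∀ᵐ x ∂volume.restrict (triangleSet T), x ∈ triangleSet T :=
      ae_restrict_mem ((Set.finite_range T).isCompact_convexHull ℝ).measurableSet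
    filter_upwards [hmem] with x hx
    rw [triangleSet, T.convexHull_eq_nonneg_coord] at hx
    have s1 := T.sum_coord_apply_eq_one x
    refine div_nonneg (Finset.prod_nonneg fun j _ => pow_nonneg (hx j) _)
      (Finset.prod_nonneg fun j _ => pow_nonneg ?_ _)
    rw [← s1]
    exact sub_nonneg.2 (Finset.single_le_sum (f := fun i => T.coord i x) (fun i _ => hx i)
      (Finset.mem_univ j))
  rw [IntegrableOn, Integrable, and_iff_right hm.aestronglyMeasurable,
    hasFiniteIntegral_iff_ofReal hnn, hc, lt_top_iff_ne_top, not_iff_not, ENNReal.mul_eq_top]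
  simp [h0, ht]

lemma nonempty_affineBasis_plane :
    Nonempty (AffineBasis (Fin 3) ℝ (EuclideanSpace ℝ (Fin 2))) :=
  AffineBasis.exists_affineBasis_of_finiteDimensional (by simp)

/-! ### Symmetry and the convergence criterion. -/

/-- Relabelling the vertices of an auxiliary triangle leaves its point set unchanged, so the
symmetry needs no change of variables on the simplex. -/
lemma stdLint_comp_perm (σ : Equiv.Perm (Fin 3)) (α β : Fin 3 → ℕ) :
    stdLint (α ∘ σ) (β ∘ σ) = stdLint α β := by
  obtain ⟨T⟩ := nonempty_affineBasis_plane
  have h : meanIntegral (T.reindex σ.symm) (α ∘ σ) (β ∘ σ) = meanIntegral T α β := by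
    have h1 : triangleSet (T.reindex σ.symm) = triangleSet T := by
      rw [triangleSet, triangleSet, AffineBasis.coe_reindex, Equiv.symm_symm,
        σ.surjective.range_comp]
    have h2 : ratFunOn (T.reindex σ.symm) (α ∘ σ) (β ∘ σ) = ratFunOn T α β := by
      funext x
      simp only [ratFunOn, ratFun, AffineBasis.coord_reindex, Equiv.symm_symm, Function.comp_apply]
      rw [Equiv.prod_comp σ (fun j => T.coord j x ^ α j),
        Equiv.prod_comp σ (fun j => (1 - T.coord j x) ^ β j)]
    rw [meanIntegral, meanIntegral, h1, h2]
  rw [meanIntegral_eq, meanIntegral_eq] at h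
  exact (ENNReal.mul_right_inj (by norm_num) (by norm_num)).1 h

/-- Two entries below `1 / 2` would force the sum below `2`. Hence all but one inverse factor are
bounded by `2 ^ β j`. -/
lemma inv_prod_one_sub_pow_le {u : Fin 3 → ℝ} (hu : ∀ j, 0 < u j) (hu1 : ∀ j, u j ≤ 1)
    (hs : ∑ j, u j = 2) (β : Fin 3 → ℕ) :
    (∏ j, u j ^ β j)⁻¹ ≤ 2 ^ (∑ j, β j) * ∑ j, (u j ^ β j)⁻¹ := by
  rw [Fin.sum_univ_three] at hs
  have hbig : ∃ k, ∀ j, j ≠ k → 1 / 2 ≤ u j := by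
    by_contra! hcon
    obtain ⟨a, -, ha⟩ := hcon 0
    obtain ⟨b, hb, hb'⟩ := hcon a
    have h0 := hu1 0; have h1 := hu1 1; have h2 := hu1 2
    fin_cases a <;> fin_cases b <;> simp at * <;> linarith
  obtain ⟨k, hk⟩ := hbig
  have h1 : ∀ j, j ≠ k → (u j ^ β j)⁻¹ ≤ 2 ^ β j := fun j hj => by
    rw [← inv_pow]
    refine pow_le_pow_left₀ (inv_nonneg.2 (hu j).le) ?_ _
    rw [inv_le_comm₀ (hu j) two_pos]
    simpa using hk j hj
  calc (∏ j, u j ^ β j)⁻¹ = (∏ j ∈ Finset.univ.erase k, (u j ^ β j)⁻¹) * (u k ^ β k)⁻¹ := by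
        rw [← Finset.prod_inv_distrib, Finset.prod_erase_mul _ _ (Finset.mem_univ k)]
    _ ≤ (∏ j ∈ Finset.univ.erase k, 2 ^ β j) * (u k ^ β k)⁻¹ := by
        refine mul_le_mul_of_nonneg_right (Finset.prod_le_prod (fun j _ => ?_) fun j hj => ?_) ?_
        · have := hu j; positivity
        · exact h1 j (Finset.ne_of_mem_erase hj)
        · have := hu k; positivity
    _ ≤ 2 ^ (∑ j, β j) * ∑ j, (u j ^ β j)⁻¹ := by
        rw [Finset.prod_pow_eq_pow_sum]
        have hnn : ∀ j, 0 ≤ (u j ^ β j)⁻¹ := fun j => by have := hu j; positivity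
        refine mul_le_mul ?_ (Finset.single_le_sum (f := fun j => (u j ^ β j)⁻¹)
          (fun j _ => hnn j) (Finset.mem_univ k)) (hnn k) (by positivity)
        exact pow_le_pow_right₀ one_le_two (Finset.sum_le_sum_of_subset (Finset.erase_subset _ _))

lemma stdLint_single_ne_top (α : Fin 3 → ℕ) (j : Fin 3) (k : ℕ) (h : α j + k ≤ ∑ i, α i + 1) :
    stdLint α (Pi.single j k) ≠ ⊤ := by
  rw [← stdLint_comp_perm (Equiv.swap j 1)]
  have : (Pi.single j k : Fin 3 → ℕ) ∘ Equiv.swap j 1 = ![0, k, 0] := by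
    funext i; fin_cases j <;> fin_cases i <;> rfl
  rw [this, stdLint_single]
  · exact ENNReal.ofReal_ne_top
  · rw [Fin.sum_univ_three] at h
    fin_cases j <;> simp [Equiv.swap_apply_def] at h ⊢ <;> omega

/-- The criterion `max_j (α_j + β_j) ≤ |α| + 1` for convergence. -/
def Admissible (α β : Fin 3 → ℕ) : Prop := ∀ j, α j + β j ≤ ∑ i, α i + 1

lemma Admissible.stdLint_ne_top {α β : Fin 3 → ℕ} (h : Admissible α β) : stdLint α β ≠ ⊤ := by
  have hle : stdLint α β ≤ ENNReal.ofReal (2 ^ (∑ j, β j)) *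
      ∑ j, stdLint α (Pi.single j (β j)) := by
    simp only [stdLint]
    rw [← lintegral_finsetSum _ fun j _ => (measurable_stdRatFun _ _).ennreal_ofReal,
      ← lintegral_const_mul _ (Finset.measurable_sum _ fun j _ =>
        (measurable_stdRatFun _ _).ennreal_ofReal)]
    refine setLIntegral_mono' measurableSet_stdSimplex2 fun p hp => ?_
    rw [← ENNReal.ofReal_sum_of_nonneg fun j _ => stdRatFun_nonneg _ _ hp,
      ← ENNReal.ofReal_mul (by positivity)]
    refine ENNReal.ofReal_le_ofReal ?_
    obtain ⟨h1, h2, h3⟩ := hp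
    have hl : ∀ j, 0 < (![1 - p.1 - p.2, p.1, p.2] : Fin 3 → ℝ) j ∧
        (![1 - p.1 - p.2, p.1, p.2] : Fin 3 → ℝ) j < 1 := by
      intro j; fin_cases j <;> simp <;> constructor <;> linarith
    have hs : ∑ j, (1 - (![1 - p.1 - p.2, p.1, p.2] : Fin 3 → ℝ) j) = 2 := by
      simp [Fin.sum_univ_three]; ring
    simp only [stdRatFun, ratFun]
    generalize (![1 - p.1 - p.2, p.1, p.2] : Fin 3 → ℝ) = l at hl hs
    have key := inv_prod_one_sub_pow_le (fun j => sub_pos.2 (hl j).2)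
      (fun j => by linarith [(hl j).1]) hs β
    have hsingle (j : Fin 3) : ∏ i, (1 - l i) ^ (Pi.single j (β j) : Fin 3 → ℕ) i =
        (1 - l j) ^ β j := by
      rw [Finset.prod_eq_single j] <;> simp +contextual
    simp only [hsingle, div_eq_mul_inv]
    rw [← Finset.mul_sum, mul_left_comm]
    exact mul_le_mul_of_nonneg_left key (Finset.prod_nonneg fun j _ => pow_nonneg (hl j).1.le _)
  refine ne_top_of_le_ne_top (ENNReal.mul_ne_top ENNReal.ofReal_ne_top ?_) hle
  exact ENNReal.sum_ne_top.2 fun j _ => stdLint_single_ne_top α j (β j) (h j)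

lemma stdLint_eq_top_of_not_admissible {α β : Fin 3 → ℕ} (h : ¬ Admissible α β) :
    stdLint α β = ⊤ := by
  simp only [Admissible, not_forall, not_le] at h
  obtain ⟨j, hj⟩ := h
  rw [← stdLint_comp_perm (Equiv.swap j 1)]
  refine stdLint_eq_top _ _ ?_
  rw [Fin.sum_univ_three] at hj
  fin_cases j <;> simp [Equiv.swap_apply_def] at hj ⊢ <;> omega

/-! ### Mean values as real numbers. -/

lemma integrableOn_stdSimplex2_of_lintegral_ne_top {f : ℝ × ℝ → ℝ} (hf : Measurable f)
    (h0 : ∀ p ∈ stdSimplex2, 0 ≤ f p)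
    (h : ∫⁻ p in stdSimplex2, ENNReal.ofReal (f p) ≠ ⊤) : IntegrableOn f stdSimplex2 := by
  refine ⟨hf.aestronglyMeasurable, ?_⟩
  rw [hasFiniteIntegral_iff_ofReal]
  · exact lt_top_iff_ne_top.2 h
  · filter_upwards [ae_restrict_mem measurableSet_stdSimplex2] with p hp using h0 p hp

lemma integral_stdSimplex2_eq_toReal {f : ℝ × ℝ → ℝ} (hf : Measurable f)
    (h0 : ∀ p ∈ stdSimplex2, 0 ≤ f p) :
    ∫ p in stdSimplex2, f p = (∫⁻ p in stdSimplex2, ENNReal.ofReal (f p)).toReal := by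
  refine integral_eq_lintegral_of_nonneg_ae ?_ hf.aestronglyMeasurable
  filter_upwards [ae_restrict_mem measurableSet_stdSimplex2] with p hp using h0 p hp

lemma Admissible.integrableOn {α β : Fin 3 → ℕ} (h : Admissible α β) :
    IntegrableOn (stdRatFun α β) stdSimplex2 :=
  integrableOn_stdSimplex2_of_lintegral_ne_top (measurable_stdRatFun _ _)
    (fun _ hp => stdRatFun_nonneg _ _ hp) h.stdLint_ne_top

/-- The mean value of `λ ^ α / (1 - λ) ^ β` over the standard simplex, as a real number. -/
noncomputable def stdMean (α β : Fin 3 → ℕ) : ℝ := 2 * ∫ p in stdSimplex2, stdRatFun α β p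

lemma stdMean_eq_toReal (α β : Fin 3 → ℕ) : stdMean α β = 2 * (stdLint α β).toReal := by
  rw [stdMean, integral_stdSimplex2_eq_toReal (measurable_stdRatFun _ _)
    (fun _ hp => stdRatFun_nonneg _ _ hp), stdLint]

lemma stdMean_comp_perm (σ : Equiv.Perm (Fin 3)) (α β : Fin 3 → ℕ) :
    stdMean (α ∘ σ) (β ∘ σ) = stdMean α β := by
  rw [stdMean_eq_toReal, stdMean_eq_toReal, stdLint_comp_perm]

lemma stdMean_single (α : Fin 3 → ℕ) (k : ℕ) (hk : k ≤ α 0 + α 2 + 1) :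
    stdMean α ![0, k, 0] =
      2 * (betaFrac (α 0) (α 2) * betaFrac (α 1) (α 0 + α 2 + 1 - k)) := by
  rw [stdMean_eq_toReal, stdLint_single _ _ hk, ENNReal.toReal_ofReal]
  exact (mul_pos (betaFrac_pos _ _) (betaFrac_pos _ _)).le

lemma stdMean_single_two (α : Fin 3 → ℕ) (k : ℕ) (hk : k ≤ α 0 + α 1 + 1) :
    stdMean α ![0, 0, k] =
      2 * (betaFrac (α 0) (α 1) * betaFrac (α 2) (α 0 + α 1 + 1 - k)) := by
  rw [← stdMean_comp_perm (Equiv.swap 1 2)]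
  have : (![0, 0, k] : Fin 3 → ℕ) ∘ Equiv.swap 1 2 = ![0, k, 0] := by
    funext i; fin_cases i <;> rfl
  rw [this]
  exact stdMean_single (α ∘ Equiv.swap 1 2) k hk

lemma admissible_iff {α β : Fin 3 → ℕ} : Admissible α β ↔
    α 0 + β 0 ≤ α 0 + α 1 + α 2 + 1 ∧ α 1 + β 1 ≤ α 0 + α 1 + α 2 + 1 ∧
      α 2 + β 2 ≤ α 0 + α 1 + α 2 + 1 := by
  simp [Admissible, Fin.forall_fin_succ, Fin.sum_univ_three]

lemma Admissible.comp_perm {α β : Fin 3 → ℕ} (h : Admissible α β) (σ : Equiv.Perm (Fin 3)) :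
    Admissible (α ∘ σ) (β ∘ σ) := fun j => by
  have := h (σ j)
  rwa [← Equiv.sum_comp σ α] at this

/-! ### The identities behind `computeI`. -/

lemma stdSimplex2_pos {p : ℝ × ℝ} (hp : p ∈ stdSimplex2) :
    p.1 + p.2 ≠ 0 ∧ 1 - p.1 ≠ 0 ∧ 1 - p.2 ≠ 0 := by
  obtain ⟨h1, h2, h3⟩ := hp
  exact ⟨by linarith, by linarith, by linarith⟩

/-- Multiply the integrand by `1 = (1 / 2) * ∑ (1 - λ j)`. -/
lemma stdMean_of_one_le {α β : Fin 3 → ℕ} (h : Admissible α β) (hβ : ∀ j, 1 ≤ β j) :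
    stdMean α β = 1 / 2 * (stdMean α (β - unitIdx 0) + stdMean α (β - unitIdx 1) +
      stdMean α (β - unitIdx 2)) := by
  have hadm (i : Fin 3) : Admissible α (β - unitIdx i) := fun j =>
    le_trans (Nat.add_le_add_left (Nat.sub_le _ _) _) (h j)
  have hpt : ∀ p ∈ stdSimplex2, stdRatFun α β p = 1 / 2 * (stdRatFun α (β - unitIdx 0) p +
      stdRatFun α (β - unitIdx 1) p + stdRatFun α (β - unitIdx 2) p) := by
    intro p hp
    obtain ⟨h1, h2, h3⟩ := stdSimplex2_pos hp
    simp only [stdRatFun_eq, Pi.sub_apply, unitIdx, Pi.single_apply]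
    obtain ⟨b0, hb0⟩ := Nat.exists_eq_add_of_le (hβ 0)
    obtain ⟨b1, hb1⟩ := Nat.exists_eq_add_of_le (hβ 1)
    obtain ⟨b2, hb2⟩ := Nat.exists_eq_add_of_le (hβ 2)
    simp [hb0, hb1, hb2, pow_add]
    field_simp
    ring
  simp only [stdMean]
  rw [setIntegral_congr_fun measurableSet_stdSimplex2 hpt, integral_const_mul,
    integral_add ((hadm 0).integrableOn.fun_add (hadm 1).integrableOn) (hadm 2).integrableOn,
    integral_add (hadm 0).integrableOn (hadm 1).integrableOn]
  ring

/-- Replace one factor `λ 0` by `(1 - λ k) - λ i`. -/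
lemma stdMean_eq_sub {α β : Fin 3 → ℕ} (i k : Fin 3) (hik : i = 1 ∧ k = 2 ∨ i = 2 ∧ k = 1)
    (hα : 1 ≤ α 0) (hβ : 1 ≤ β k)
    (h1 : Admissible (α - unitIdx 0) (β - unitIdx k))
    (h2 : Admissible (α - unitIdx 0 + unitIdx i) β) :
    stdMean α β = stdMean (α - unitIdx 0) (β - unitIdx k) -
      stdMean (α - unitIdx 0 + unitIdx i) β := by
  have hpt : ∀ p ∈ stdSimplex2, stdRatFun α β p =
      stdRatFun (α - unitIdx 0) (β - unitIdx k) p -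
        stdRatFun (α - unitIdx 0 + unitIdx i) β p := by
    intro p hp
    obtain ⟨h1, h2, h3⟩ := stdSimplex2_pos hp
    simp only [stdRatFun_eq, Pi.sub_apply, Pi.add_apply, unitIdx, Pi.single_apply]
    obtain ⟨a, ha⟩ := Nat.exists_eq_add_of_le hα
    obtain ⟨b, hb⟩ := Nat.exists_eq_add_of_le hβ
    rcases hik with ⟨rfl, rfl⟩ | ⟨rfl, rfl⟩ <;>
    · simp [ha, hb, pow_add]
      field_simp
      try ring
  simp only [stdMean]
  rw [setIntegral_congr_fun measurableSet_stdSimplex2 hpt,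
    integral_sub h1.integrableOn h2.integrableOn]
  ring

/-- Here `λ 0 = (1 - λ 1) * (1 - λ 2) - λ 1 * λ 2`. The first product is split symmetrically into
halves, using `1 - λ 2 = λ 0 + λ 1` in one and `1 - λ 1 = λ 0 + λ 2` in the other. -/
lemma stdMean_eq_half_add_sub {α β : Fin 3 → ℕ} (hα : 1 ≤ α 0) (hβ1 : 1 ≤ β 1) (hβ2 : 1 ≤ β 2)
    (h1 : Admissible α (β - unitIdx 1))
    (h1' : Admissible (α - unitIdx 0 + unitIdx 1) (β - unitIdx 1))
    (h2 : Admissible α (β - unitIdx 2))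
    (h2' : Admissible (α - unitIdx 0 + unitIdx 2) (β - unitIdx 2))
    (h3 : Admissible (α - unitIdx 0 + unitIdx 1 + unitIdx 2) β) :
    stdMean α β = 1 / 2 * ((stdMean α (β - unitIdx 1) +
        stdMean (α - unitIdx 0 + unitIdx 1) (β - unitIdx 1)) +
      (stdMean α (β - unitIdx 2) + stdMean (α - unitIdx 0 + unitIdx 2) (β - unitIdx 2))) -
      stdMean (α - unitIdx 0 + unitIdx 1 + unitIdx 2) β := by
  have hpt : ∀ p ∈ stdSimplex2, stdRatFun α β p = 1 / 2 * ((stdRatFun α (β - unitIdx 1) p +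
        stdRatFun (α - unitIdx 0 + unitIdx 1) (β - unitIdx 1) p) +
      (stdRatFun α (β - unitIdx 2) p +
        stdRatFun (α - unitIdx 0 + unitIdx 2) (β - unitIdx 2) p)) -
      stdRatFun (α - unitIdx 0 + unitIdx 1 + unitIdx 2) β p := by
    intro p hp
    obtain ⟨h1, h2, h3⟩ := stdSimplex2_pos hp
    simp only [stdRatFun_eq, Pi.sub_apply, Pi.add_apply, unitIdx, Pi.single_apply]
    obtain ⟨a, ha⟩ := Nat.exists_eq_add_of_le hα
    obtain ⟨b, hb⟩ := Nat.exists_eq_add_of_le hβ1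
    obtain ⟨c, hc⟩ := Nat.exists_eq_add_of_le hβ2
    simp [ha, hb, hc, pow_add]
    field_simp
    ring
  simp only [stdMean]
  have i1 := h1.integrableOn.fun_add h1'.integrableOn
  have i2 := h2.integrableOn.fun_add h2'.integrableOn
  rw [setIntegral_congr_fun measurableSet_stdSimplex2 hpt,
    integral_sub ((i1.fun_add i2).const_mul (1 / 2)) h3.integrableOn, integral_const_mul,
    integral_add i1 i2, integral_add h1.integrableOn h1'.integrableOn,
    integral_add h2.integrableOn h2'.integrableOn]
  ring

/-! ### The recursion and the base case of `computeJ`. -/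

lemma stdMean_pair_recursion {a₁ a₂ b₁ k : ℕ} (hb₁ : b₁ ≤ a₂ + 1) (hk : k ≤ a₁) :
    (k : ℝ) * stdMean ![0, a₁, a₂] ![0, b₁, k + 1] =
      ((k : ℝ) - 1 - a₂) * stdMean ![0, a₁, a₂] ![0, b₁, k] +
        2 * betaFrac (a₁ - k) (a₂ + 1 - b₁) := by
  -- The second factor is the `y`-derivative of `y ^ (a₂ + 1) / (1 - y) ^ k`. At the endpoint `y = 1
  -- - x` one has `1 - y = x`, so the fibre integral is a product of powers of `x` and `1 - x`.
  set f : ℝ × ℝ → ℝ := fun p => p.1 ^ a₁ / (1 - p.1) ^ b₁ *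
    (((a₂ : ℝ) + 1) * (p.2 ^ a₂ / (1 - p.2) ^ k) +
      (k : ℝ) * (p.2 ^ (a₂ + 1) / (1 - p.2) ^ (k + 1))) with hf
  have hfm : Measurable f := by rw [hf]; fun_prop
  have hf0 : ∀ p ∈ stdSimplex2, 0 ≤ f p := by
    rintro p ⟨h1, h2, h3⟩
    have h5 : 0 < 1 - p.1 := by linarith
    have h6 : 0 < 1 - p.2 := by linarith
    simp only [hf]
    positivity
  have hd : ∀ x ∈ Set.Ioo (0 : ℝ) 1, ∀ y ∈ Set.uIcc 0 (1 - x), 1 - y ≠ 0 := by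
    intro x hx y hy
    rw [Set.uIcc_of_le (by linarith [hx.2])] at hy
    have := hy.2; have := hx.1
    exact ne_of_gt (by linarith)
  have hcont : ∀ x ∈ Set.Ioo (0 : ℝ) 1,
      IntervalIntegrable (fun y => ((a₂ : ℝ) + 1) * (y ^ a₂ / (1 - y) ^ k) +
        (k : ℝ) * (y ^ (a₂ + 1) / (1 - y) ^ (k + 1))) volume 0 (1 - x) := by
    intro x hx
    refine ContinuousOn.intervalIntegrable ?_
    have h1 (m : ℕ) : ∀ y ∈ Set.uIcc 0 (1 - x), (1 - y) ^ m ≠ 0 := fun y hy =>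
      pow_ne_zero _ (hd x hx y hy)
    refine ContinuousOn.add (continuousOn_const.mul (ContinuousOn.div ?_ ?_ (h1 _)))
      (continuousOn_const.mul (ContinuousOn.div ?_ ?_ (h1 _))) <;> fun_prop
  have hval : ∫⁻ p in stdSimplex2, ENNReal.ofReal (f p) =
      ENNReal.ofReal (betaFrac (a₁ - k) (a₂ + 1 - b₁)) := by
    rw [← one_mul (betaFrac _ _), ← lintegral_pow_mul_one_sub_pow zero_le_one]
    refine lintegral_stdSimplex2_of_fiber hfm hf0 (fun x hx => ?_) (fun x hx => ?_)
    · simp only [hf]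
      exact (hcont x hx).const_mul _
    · simp only [hf]
      rw [intervalIntegral.integral_const_mul,
        intervalIntegral.integral_eq_sub_of_hasDerivAt (f := fun y => y ^ (a₂ + 1) / (1 - y) ^ k)
          _ (hcont x hx)]
      · have hx0 : x ≠ 0 := hx.1.ne'
        have hx1 : 1 - x ≠ 0 := (sub_pos.2 hx.2).ne'
        rw [pow_sub₀ _ hx0 hk, pow_sub₀ _ hx1 hb₁]
        simp only [sub_sub_cancel, sub_zero, ne_eq, Nat.add_eq_zero_iff, one_ne_zero, and_false,
          not_false_eq_true, zero_pow, zero_div]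
        field_simp
      · intro y hy
        have hy1 := hd x hx y hy
        have h1 : HasDerivAt (fun y : ℝ => (1 - y) ^ k) ((k : ℝ) * (1 - y) ^ (k - 1) * (-1)) y := by
          simpa using ((hasDerivAt_id y).const_sub 1).fun_pow k
        have h2 : HasDerivAt (fun y : ℝ => y ^ (a₂ + 1)) (((a₂ + 1 : ℕ) : ℝ) * y ^ a₂) y := by
          simpa using hasDerivAt_pow (a₂ + 1) y
        refine (h2.div h1 (pow_ne_zero _ hy1)).congr_deriv ?_
        rcases k with _ | k
        · simp
        · simp only [Nat.add_sub_cancel]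
          push_cast
          field_simp
          ring
  have hint : ∫ p in stdSimplex2, f p = betaFrac (a₁ - k) (a₂ + 1 - b₁) := by
    rw [integral_stdSimplex2_eq_toReal hfm hf0, hval, ENNReal.toReal_ofReal (betaFrac_pos _ _).le]
  have hA : Admissible ![0, a₁, a₂] ![0, b₁, k + 1] := by
    rw [admissible_iff]; simp; omega
  have hB : Admissible ![0, a₁, a₂] ![0, b₁, k] := by
    rw [admissible_iff]; simp; omega
  -- Writing `y = 1 - (1 - y)` in the second term of `f` brings every numerator back to `y ^ a₂`.
  have hpt : ∀ p ∈ stdSimplex2, f p = (k : ℝ) * stdRatFun ![0, a₁, a₂] ![0, b₁, k + 1] p +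
      ((a₂ : ℝ) + 1 - k) * stdRatFun ![0, a₁, a₂] ![0, b₁, k] p := by
    intro p hp
    obtain ⟨h1, h2, h3⟩ := stdSimplex2_pos hp
    simp only [hf, stdRatFun_eq, Matrix.cons_val_zero, Matrix.cons_val_one, Matrix.cons_val,
      pow_zero, one_mul]
    field_simp
    ring
  rw [setIntegral_congr_fun measurableSet_stdSimplex2 hpt,
    integral_add (hA.integrableOn.const_mul _) (hB.integrableOn.const_mul _),
    integral_const_mul, integral_const_mul] at hint
  simp only [stdMean]
  linear_combination 2 * hint

lemma admissible_pair_one (a₁ a₂ : ℕ) : Admissible ![0, a₁, a₂] ![0, 1, 1] := by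
  rw [admissible_iff]; simp

lemma betaFrac_zero_left (n : ℕ) : betaFrac 0 n = 1 / ((n : ℝ) + 1) := by
  have : ((n ! : ℕ) : ℝ) ≠ 0 := by positivity
  simp only [betaFrac, Nat.factorial_zero, zero_add, Nat.factorial_succ]
  push_cast
  field_simp

/-- The extra factor `y = 1 - (1 - y)` cancels the second denominator in the correction term. -/
lemma stdMean_pair_one_succ_right (a₁ a₂ : ℕ) : stdMean ![0, a₁, a₂ + 1] ![0, 1, 1] =
    stdMean ![0, a₁, a₂] ![0, 1, 1] - 2 * (1 / ((a₂ : ℝ) + 1) * betaFrac a₁ a₂) := by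
  have hadm : Admissible ![0, a₁, a₂] ![0, 1, 0] := by rw [admissible_iff]; simp; omega
  have hpt : ∀ p ∈ stdSimplex2, stdRatFun ![0, a₁, a₂ + 1] ![0, 1, 1] p =
      stdRatFun ![0, a₁, a₂] ![0, 1, 1] p - stdRatFun ![0, a₁, a₂] ![0, 1, 0] p := by
    intro p hp
    obtain ⟨h1, h2, h3⟩ := stdSimplex2_pos hp
    simp only [stdRatFun_eq, Matrix.cons_val_zero, Matrix.cons_val_one, Matrix.cons_val,
      pow_zero, one_mul, pow_succ]
    field_simp
    ring
  have hs := stdMean_single ![0, a₁, a₂] 1 (by simp)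
  simp only [Matrix.cons_val_zero, Matrix.cons_val_one, Matrix.cons_val, zero_add,
    Nat.add_sub_cancel, betaFrac_zero_left] at hs
  rw [← hs]
  simp only [stdMean]
  rw [setIntegral_congr_fun measurableSet_stdSimplex2 hpt,
    integral_sub (admissible_pair_one _ _).integrableOn hadm.integrableOn]
  ring

lemma stdMean_pair_swap (a₁ a₂ b₁ b₂ : ℕ) :
    stdMean ![0, a₁, a₂] ![0, b₁, b₂] = stdMean ![0, a₂, a₁] ![0, b₂, b₁] := by
  rw [← stdMean_comp_perm (Equiv.swap 1 2)]
  congr 1 <;> funext i <;> fin_cases i <;> rfl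

lemma tendsto_stdMean_zero_pair_one :
    Filter.Tendsto (fun n : ℕ => stdMean ![0, 0, n] ![0, 1, 1]) Filter.atTop (nhds 0) := by
  have h : Filter.Tendsto (fun n : ℕ => ∫ p in stdSimplex2, stdRatFun ![0, 0, n] ![0, 1, 1] p)
      Filter.atTop (nhds (∫ p in stdSimplex2, (0 : ℝ))) := by
    have hform (n : ℕ) (p : ℝ × ℝ) : stdRatFun ![0, 0, n] ![0, 1, 1] p =
        p.2 ^ n * stdRatFun ![0, 0, 0] ![0, 1, 1] p := by
      simp only [stdRatFun_eq, Matrix.cons_val_zero, Matrix.cons_val_one, Matrix.cons_val,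
        pow_zero, one_mul, mul_one, mul_div_assoc']
    refine tendsto_integral_of_dominated_convergence (stdRatFun ![0, 0, 0] ![0, 1, 1])
      (fun n => (measurable_stdRatFun _ _).aestronglyMeasurable)
      (admissible_pair_one 0 0).integrableOn (fun n => ?_) ?_
    · filter_upwards [ae_restrict_mem measurableSet_stdSimplex2] with p hp
      rw [Real.norm_of_nonneg (stdRatFun_nonneg _ _ hp), hform]
      obtain ⟨h1, h2, h3⟩ := id hp
      exact mul_le_of_le_one_left (stdRatFun_nonneg _ _ hp) (pow_le_one₀ h2.le (by linarith))
    · filter_upwards [ae_restrict_mem measurableSet_stdSimplex2] with p hp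
      obtain ⟨h1, h2, h3⟩ := id hp
      refine Filter.Tendsto.congr (fun n => (hform n p).symm) ?_
      simpa using (tendsto_pow_atTop_nhds_zero_of_lt_one h2.le (by linarith)).mul_const
        (stdRatFun ![0, 0, 0] ![0, 1, 1] p)
  simpa [stdMean] using h.const_mul 2

lemma stdMean_zero_pair_one (n : ℕ) : stdMean ![0, 0, n] ![0, 1, 1] =
    stdMean ![0, 0, 0] ![0, 1, 1] - 2 * ∑ i ∈ Finset.Icc 1 n, 1 / (i : ℝ) ^ 2 := by
  induction n with
  | zero => simp
  | succ n ih =>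
    rw [stdMean_pair_one_succ_right, ih, betaFrac_zero_left,
      Finset.sum_Icc_succ_top (by omega)]
    have : (n : ℝ) + 1 ≠ 0 := by positivity
    push_cast
    field_simp
    ring

/-- The means with numerator `y ^ n` tend to `0` by dominated convergence, while each step lowers
them by `2 / (n + 1) ^ 2`; so the initial value is `2 * ζ(2)`. -/
lemma stdMean_zero_zero_pair_one : stdMean ![0, 0, 0] ![0, 1, 1] = Real.pi ^ 2 / 3 := by
  have h1 : Filter.Tendsto (fun n : ℕ => ∑ i ∈ Finset.Icc 1 n, 1 / (i : ℝ) ^ 2)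
      Filter.atTop (nhds (Real.pi ^ 2 / 6)) := by
    refine (((Filter.tendsto_add_atTop_iff_nat 1).2 hasSum_zeta_two.tendsto_sum_nat)).congr
      fun n => ?_
    rw [Finset.range_eq_Ico, Finset.sum_eq_sum_Ico_succ_bot (by omega)]
    simp [← Finset.Ico_add_one_right_eq_Icc]
  have h2 := tendsto_stdMean_zero_pair_one.congr stdMean_zero_pair_one
  have h3 := tendsto_nhds_unique h2 (tendsto_const_nhds.sub (h1.const_mul 2))
  linarith

lemma stdMean_pair_one (a₁ a₂ : ℕ) : stdMean ![0, a₁, a₂] ![0, 1, 1] =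
    -2 * ∑ i ∈ Finset.Icc 1 a₂, 1 / (i : ℝ) ^ 2 + Real.pi ^ 2 / 3
      - 2 * ∑ j ∈ Finset.Icc 1 a₁, 1 / (j : ℝ) *
        (((a₂ ! : ℕ) : ℝ) * (((j - 1)! : ℕ) : ℝ) / (((a₂ + j)! : ℕ) : ℝ)) := by
  induction a₁ with
  | zero =>
    rw [stdMean_zero_pair_one, stdMean_zero_zero_pair_one]
    simp
    ring
  | succ n ih =>
    rw [stdMean_pair_swap, stdMean_pair_one_succ_right, stdMean_pair_swap, ih,
      Finset.sum_Icc_succ_top (by omega), betaFrac]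
    push_cast
    simp only [← add_assoc]
    ring

/-! ### Termination and correctness. -/

lemma Equiv.Perm.fin_two_cases :
    ∀ σ : Equiv.Perm (Fin 2), (σ 0 = 0 ∧ σ 1 = 1) ∨ (σ 0 = 1 ∧ σ 1 = 0) := by
  decide

/-- Strong induction on `b₁ + b₂`. Positivity of both exponents is preserved by the recursion and
holds whenever `computeI` calls `computeJ`. -/
lemma exists_computeJ_eq (s : SortRule 2) (n : ℕ) : ∀ a₁ a₂ b₁ b₂ : ℕ, b₁ + b₂ = n →
    1 ≤ b₁ → 1 ≤ b₂ → b₁ ≤ a₂ + 1 → b₂ ≤ a₁ + 1 →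
    ∃ N, ∀ depth ≥ N, computeJ s depth a₁ a₂ b₁ b₂ =
      some ((stdMean ![0, a₁, a₂] ![0, b₁, b₂] : ℝ) : EReal) := by
  induction n using Nat.strong_induction_on with
  | _ n ih =>
  intro a₁ a₂ b₁ b₂ hn h1 h2 h12 h21
  have hmax : ¬ max (a₁ + b₁) (a₂ + b₂) > a₁ + a₂ + 1 := by
    rw [gt_iff_lt, not_lt, max_le_iff]; omega
  have hsort := s.sorted ![a₁, a₂] ![b₁, b₂] (Fin.zero_le 1)
  simp only [Function.comp_apply] at hsort
  obtain ⟨α₁, hα₁⟩ : ∃ x, ![a₁, a₂] (s.perm ![a₁, a₂] ![b₁, b₂] 0) = x := ⟨_, rfl⟩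
  obtain ⟨α₂, hα₂⟩ : ∃ x, ![a₁, a₂] (s.perm ![a₁, a₂] ![b₁, b₂] 1) = x := ⟨_, rfl⟩
  obtain ⟨β₁, hβ₁⟩ : ∃ x, ![b₁, b₂] (s.perm ![a₁, a₂] ![b₁, b₂] 0) = x := ⟨_, rfl⟩
  obtain ⟨β₂, hβ₂⟩ : ∃ x, ![b₁, b₂] (s.perm ![a₁, a₂] ![b₁, b₂] 1) = x := ⟨_, rfl⟩
  rw [hβ₁, hβ₂] at hsort
  have hcases : stdMean ![0, a₁, a₂] ![0, b₁, b₂] = stdMean ![0, α₁, α₂] ![0, β₁, β₂] ∧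
      β₁ + β₂ = n ∧ 1 ≤ β₁ ∧ β₁ ≤ α₂ + 1 ∧ β₂ ≤ α₁ + 1 := by
    rcases Equiv.Perm.fin_two_cases (s.perm ![a₁, a₂] ![b₁, b₂]) with ⟨e0, e1⟩ | ⟨e0, e1⟩ <;>
      rw [e0] at hα₁ hβ₁ <;> rw [e1] at hα₂ hβ₂ <;>
      simp only [Matrix.cons_val_zero, Matrix.cons_val_one] at hα₁ hα₂ hβ₁ hβ₂ <;>
      subst hα₁ hα₂ hβ₁ hβ₂
    · exact ⟨rfl, hn, h1, h12, h21⟩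
    · exact ⟨stdMean_pair_swap _ _ _ _, by omega, h2, h21, h12⟩
  obtain ⟨hmean, hsum, hβ₁1, hβ₁2, hβ₂1⟩ := hcases
  rw [hmean]
  have hβ₁0 : β₁ ≠ 0 := by omega
  by_cases hb1 : β₁ = 1
  · by_cases hb2 : β₂ = 1
    · refine ⟨1, fun depth hd => ?_⟩
      obtain ⟨d, rfl⟩ := Nat.exists_eq_add_of_le' hd
      rw [computeJ, if_neg hmax]
      simp only [hα₁, hα₂, hβ₁, hβ₂]
      rw [if_neg hβ₁0, if_pos hb1, if_pos hb2, hb1, hb2, stdMean_pair_one]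
    · obtain ⟨k, rfl⟩ := Nat.exists_eq_add_of_le' (show 2 ≤ β₂ by omega)
      obtain ⟨N, hN⟩ := ih (1 + (k + 1)) (by omega) α₁ α₂ 1 (k + 1) rfl le_rfl (by omega)
        (by omega) (by omega)
      refine ⟨N + 1, fun depth hd => ?_⟩
      obtain ⟨d, rfl⟩ := Nat.exists_eq_add_of_le' (show 1 ≤ depth by omega)
      rw [computeJ, if_neg hmax]
      simp only [hα₁, hα₂, hβ₁, hβ₂]
      rw [if_neg hβ₁0, if_pos hb1, if_neg hb2, show k + 2 - 1 = k + 1 by omega, hN d (by omega)]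
      simp only [Option.bind_eq_bind, Option.bind_some, Option.pure_def, ← EReal.coe_mul,
        ← EReal.coe_add]
      congr 2
      have hrec := stdMean_pair_recursion (a₁ := α₁) (a₂ := α₂) (b₁ := 1) (k := k + 1)
        (by omega) (by omega)
      rw [hb1, show k + 2 = k + 1 + 1 from rfl]
      have hk : ((k + 1 : ℕ) : ℝ) ≠ 0 := by positivity
      apply mul_left_cancel₀ hk
      rw [hrec, betaFrac, show α₁ + 1 - (k + 1 + 1) = α₁ - (k + 1) by omega,
        show α₂ + 1 - 1 = α₂ by omega,
        show α₁ + α₂ + 2 - (k + 1 + 1) = α₁ - (k + 1) + α₂ + 1 by omega]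
      have hk2 : (k : ℝ) + 1 ≠ 0 := by positivity
      have hk3 : (k : ℝ) + 1 + 1 - 1 = (k : ℝ) + 1 := by ring
      push_cast
      rw [hk3]
      field_simp
      ring
  · obtain ⟨k, rfl⟩ := Nat.exists_eq_add_of_le' (show 2 ≤ β₁ by omega)
    obtain ⟨N, hN⟩ := ih (k + 1 + β₂) (by omega) α₁ α₂ (k + 1) β₂ rfl (by omega) (by omega)
      (by omega) (by omega)
    refine ⟨N + 1, fun depth hd => ?_⟩
    obtain ⟨d, rfl⟩ := Nat.exists_eq_add_of_le' (show 1 ≤ depth by omega)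
    rw [computeJ, if_neg hmax]
    simp only [hα₁, hα₂, hβ₁, hβ₂]
    rw [if_neg hβ₁0, if_neg hb1, show k + 2 - 1 = k + 1 by omega, hN d (by omega)]
    simp only [Option.bind_eq_bind, Option.bind_some, Option.pure_def, ← EReal.coe_mul,
      ← EReal.coe_add]
    congr 2
    -- The roles of the two pairs are exchanged, because this branch lowers `β₁`.
    have hrec := stdMean_pair_recursion (a₁ := α₂) (a₂ := α₁) (b₁ := β₂) (k := k + 1)
      (by omega) (by omega)
    rw [stdMean_pair_swap, stdMean_pair_swap _ _ _ (k + 1)] at hrec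
    rw [show k + 2 = k + 1 + 1 from rfl]
    have hk : ((k + 1 : ℕ) : ℝ) ≠ 0 := by positivity
    apply mul_left_cancel₀ hk
    rw [hrec, betaFrac, show α₂ + 1 - (k + 1 + 1) = α₂ - (k + 1) by omega,
      show α₁ + α₂ + 3 - (k + 1 + 1 + β₂) = α₂ - (k + 1) + (α₁ + 1 - β₂) + 1 by omega]
    have hk2 : (k : ℝ) + 1 ≠ 0 := by positivity
    have hk3 : (k : ℝ) + 1 + 1 - 1 = (k : ℝ) + 1 := by ring
    push_cast
    rw [hk3]
    field_simp
    ring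

/-- The sum of the entries of `α` at the zeros of `β`. -/
def zeroSum (α β : Fin 3 → ℕ) : ℕ := ∑ j, if β j = 0 then α j else 0

lemma zeroSum_comp_perm (σ : Equiv.Perm (Fin 3)) (α β : Fin 3 → ℕ) :
    zeroSum (α ∘ σ) (β ∘ σ) = zeroSum α β :=
  Equiv.sum_comp σ fun j => if β j = 0 then α j else 0

lemma sum_sub_unitIdx_lt {β : Fin 3 → ℕ} {j : Fin 3} (h : 1 ≤ β j) :
    ∑ i, (β - unitIdx j) i < ∑ i, β i := by
  refine Finset.sum_lt_sum (fun i _ => Nat.sub_le _ _) ⟨j, Finset.mem_univ j, ?_⟩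
  simp only [Pi.sub_apply, unitIdx, Pi.single_eq_same]
  omega

lemma stdMean_of_zero_zero {α β : Fin 3 → ℕ} (h0 : β 0 = 0) (h1 : β 1 = 0)
    (h2 : β 2 ≤ α 0 + α 1 + 1) :
    stdMean α β = 2 * ((((α 0)! : ℕ) : ℝ) * (((α 1)! : ℕ) : ℝ) * (((α 2)! : ℕ) : ℝ) /
        (((α 0 + α 1 + α 2 + 2 - β 2)! : ℕ) : ℝ)) *
      ((((α 0 + α 1 + 1 - β 2)! : ℕ) : ℝ) / (((α 0 + α 1 + 1)! : ℕ) : ℝ)) := by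
  have hβ : β = ![0, 0, β 2] := by
    funext i; fin_cases i
    · exact h0
    · exact h1
    · rfl
  rw [hβ, stdMean_single_two _ _ h2, betaFrac, betaFrac]
  simp only [Matrix.cons_val]
  rw [show α 0 + α 1 + α 2 + 2 - β 2 = α 2 + (α 0 + α 1 + 1 - β 2) + 1 by omega]
  ring

lemma exists_computeI_eq (s₂ : SortRule 2) (s₃ : SortRule 3) (n : ℕ) : ∀ (k : ℕ)
    (a b : Fin 3 → ℕ), ∑ j, b j = n → zeroSum a b = k → Admissible a b →
    ∃ N, ∀ depth ≥ N, computeI s₂ s₃ depth a b = some ((stdMean a b : ℝ) : EReal) := by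
  induction n using Nat.strong_induction_on with
  | _ n ihn =>
  intro k
  induction k using Nat.strong_induction_on with
  | _ k ihk =>
  intro a b hbn hak hab
  have hmax : ¬ max (a 0 + b 0) (max (a 1 + b 1) (a 2 + b 2)) > a 0 + a 1 + a 2 + 1 := by
    rw [gt_iff_lt, not_lt, max_le_iff, max_le_iff]; exact admissible_iff.1 hab
  obtain ⟨α, hα⟩ : ∃ α : Fin 3 → ℕ, (fun j => a (s₃.perm a b j)) = α := ⟨_, rfl⟩
  obtain ⟨β, hβ⟩ : ∃ β : Fin 3 → ℕ, (fun j => b (s₃.perm a b j)) = β := ⟨_, rfl⟩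
  have hmono : Monotone β := hβ ▸ s₃.sorted a b
  have hadm : Admissible α β := hα ▸ hβ ▸ hab.comp_perm _
  have hmean : stdMean a b = stdMean α β := hα ▸ hβ ▸ (stdMean_comp_perm _ a b).symm
  have hβn : ∑ j, β j = n := by rw [← hβ, ← hbn]; exact Equiv.sum_comp _ b
  have hαk : zeroSum α β = k := by rw [← hα, ← hβ, ← hak]; exact zeroSum_comp_perm _ a b
  have h01 : β 0 ≤ β 1 := hmono (by decide)
  have h12 : β 1 ≤ β 2 := hmono (by decide)
  clear hbn hak hab hmono
  rw [hmean]
  -- Outer induction: once `|β|` has dropped, the numerator exponents are arbitrary.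
  have stepN : ∀ {a' : Fin 3 → ℕ} {j : Fin 3}, 1 ≤ β j → Admissible a' (β - unitIdx j) →
      ∃ N, ∀ depth ≥ N, computeI s₂ s₃ depth a' (β - unitIdx j) =
        some ((stdMean a' (β - unitIdx j) : ℝ) : EReal) := fun hj h =>
    ihn _ (hβn ▸ sum_sub_unitIdx_lt hj) _ _ _ rfl rfl h
  have unfoldI : ∀ {N : ℕ} {r : EReal}, (∀ d ≥ N,
      (if β 0 = 0 ∧ β 1 = 0 then
        some ((2 * ((((α 0)! : ℕ) : ℝ) * (((α 1)! : ℕ) : ℝ) * (((α 2)! : ℕ) : ℝ) /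
            (((α 0 + α 1 + α 2 + 2 - β 2)! : ℕ) : ℝ)) *
          ((((α 0 + α 1 + 1 - β 2)! : ℕ) : ℝ) / (((α 0 + α 1 + 1)! : ℕ) : ℝ)) : ℝ) : EReal)
      else if 1 ≤ β 0 then do
        let r₀ ← computeI s₂ s₃ d α (β - unitIdx 0)
        let r₁ ← computeI s₂ s₃ d α (β - unitIdx 1)
        let r₂ ← computeI s₂ s₃ d α (β - unitIdx 2)
        return ((1 / 2 : ℝ) : EReal) * (r₀ + r₁ + r₂)
      else if α 0 = 0 then
        computeJ s₂ d (α 1) (α 2) (β 1) (β 2)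
      else if α 1 + β 1 < α 0 + α 1 + α 2 + 1 then do
        let r ← computeI s₂ s₃ d (α - unitIdx 0) (β - unitIdx 2)
        let r' ← computeI s₂ s₃ d (α - unitIdx 0 + unitIdx 1) β
        return r - r'
      else if α 2 + β 2 < α 0 + α 1 + α 2 + 1 then do
        let r ← computeI s₂ s₃ d (α - unitIdx 0) (β - unitIdx 1)
        let r' ← computeI s₂ s₃ d (α - unitIdx 0 + unitIdx 2) β
        return r - r'
      else do
        let r₁ ← computeI s₂ s₃ d α (β - unitIdx 1)
        let r₁' ← computeI s₂ s₃ d (α - unitIdx 0 + unitIdx 1) (β - unitIdx 1)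
        let r₂ ← computeI s₂ s₃ d α (β - unitIdx 2)
        let r₂' ← computeI s₂ s₃ d (α - unitIdx 0 + unitIdx 2) (β - unitIdx 2)
        let q ← computeI s₂ s₃ d (α - unitIdx 0 + unitIdx 1 + unitIdx 2) β
        return ((1 / 2 : ℝ) : EReal) * ((r₁ + r₁') + (r₂ + r₂')) - q) = some r) →
      ∃ N, ∀ depth ≥ N, computeI s₂ s₃ depth a b = some r := by
    intro N r h
    refine ⟨N + 1, fun depth hd => ?_⟩
    obtain ⟨d, rfl⟩ := Nat.exists_eq_add_of_le' (show 1 ≤ depth by omega)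
    rw [computeI, if_neg hmax, ← h d (by omega), ← hα, ← hβ]
  obtain ⟨c0, c1, c2⟩ := admissible_iff.1 hadm
  by_cases hz : β 0 = 0 ∧ β 1 = 0
  · refine unfoldI (N := 0) fun d _ => ?_
    rw [if_pos hz, stdMean_of_zero_zero hz.1 hz.2 (by omega)]
  by_cases hb0 : 1 ≤ β 0
  · have hall : ∀ j, 1 ≤ β j := fun j => by fin_cases j <;> simp <;> omega
    have hadm' (i : Fin 3) : Admissible α (β - unitIdx i) := fun j =>
      le_trans (Nat.add_le_add_left (Nat.sub_le _ _) _) (hadm j)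
    obtain ⟨N0, hN0⟩ := stepN (hall 0) (hadm' 0)
    obtain ⟨N1, hN1⟩ := stepN (hall 1) (hadm' 1)
    obtain ⟨N2, hN2⟩ := stepN (hall 2) (hadm' 2)
    refine unfoldI (N := N0 + N1 + N2) fun d hd => ?_
    rw [if_neg hz, if_pos hb0, hN0 d (by omega), hN1 d (by omega), hN2 d (by omega),
      stdMean_of_one_le hadm hall]
    simp only [Option.bind_eq_bind, Option.bind_some, Option.pure_def, EReal.coe_mul,
      EReal.coe_add]
  have hb0' : β 0 = 0 := by omega
  have hb1 : 1 ≤ β 1 := by omega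
  have hb2 : 1 ≤ β 2 := by omega
  by_cases ha0 : α 0 = 0
  · obtain ⟨N, hN⟩ := exists_computeJ_eq s₂ _ (α 1) (α 2) (β 1) (β 2) rfl hb1 hb2 (by omega)
      (by omega)
    refine unfoldI (N := N) fun d hd => ?_
    rw [if_neg hz, if_neg hb0, if_pos ha0, hN d hd]
    congr 3 <;> funext i <;> fin_cases i
    all_goals first | rfl | simp [ha0, hb0']
  -- Inner induction: `0` is now the only zero of `β`, so `zeroSum` is the entry at `0`, whatever
  -- happens to the others.
  have stepK : ∀ {a' : Fin 3 → ℕ}, a' 0 + 1 = α 0 → Admissible a' β →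
      ∃ N, ∀ depth ≥ N, computeI s₂ s₃ depth a' β =
        some ((stdMean a' β : ℝ) : EReal) := fun {a'} h h' => by
    refine ihk (zeroSum a' β) ?_ _ _ hβn rfl h'
    rw [← hαk]
    simp only [zeroSum, Fin.sum_univ_three, hb0', if_true]
    rw [if_neg (by omega), if_neg (by omega), if_neg (by omega), if_neg (by omega)]
    omega
  by_cases hs1 : α 1 + β 1 < α 0 + α 1 + α 2 + 1
  · have A1 : Admissible (α - unitIdx 0) (β - unitIdx 2) := by
      rw [admissible_iff]; simp [unitIdx]; omega
    have A2 : Admissible (α - unitIdx 0 + unitIdx 1) β := by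
      rw [admissible_iff]; simp [unitIdx]; omega
    obtain ⟨N1, hN1⟩ := stepN hb2 A1
    obtain ⟨N2, hN2⟩ := stepK (by simp [unitIdx]; omega) A2
    refine unfoldI (N := N1 + N2) fun d hd => ?_
    rw [if_neg hz, if_neg hb0, if_neg ha0, if_pos hs1, hN1 d (by omega), hN2 d (by omega),
      stdMean_eq_sub 1 2 (.inl ⟨rfl, rfl⟩) (by omega) hb2 A1 A2]
    simp only [Option.bind_eq_bind, Option.bind_some, Option.pure_def, EReal.coe_sub]
  by_cases hs2 : α 2 + β 2 < α 0 + α 1 + α 2 + 1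
  · have A1 : Admissible (α - unitIdx 0) (β - unitIdx 1) := by
      rw [admissible_iff]; simp [unitIdx]; omega
    have A2 : Admissible (α - unitIdx 0 + unitIdx 2) β := by
      rw [admissible_iff]; simp [unitIdx]; omega
    obtain ⟨N1, hN1⟩ := stepN hb1 A1
    obtain ⟨N2, hN2⟩ := stepK (by simp [unitIdx]; omega) A2
    refine unfoldI (N := N1 + N2) fun d hd => ?_
    rw [if_neg hz, if_neg hb0, if_neg ha0, if_neg hs1, if_pos hs2, hN1 d (by omega),
      hN2 d (by omega), stdMean_eq_sub 2 1 (.inr ⟨rfl, rfl⟩) (by omega) hb1 A1 A2]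
    simp only [Option.bind_eq_bind, Option.bind_some, Option.pure_def, EReal.coe_sub]
  -- Both bounds are now equalities, `α j + β j = |α| + 1` for `j = 1, 2`. Lowering `|α|` as in the
  -- two previous branches would leave the convergent range; every term here keeps `|α|` or raises
  -- it by one.
  have A1 : Admissible α (β - unitIdx 1) := by
    rw [admissible_iff]; simp [unitIdx]; omega
  have A1' : Admissible (α - unitIdx 0 + unitIdx 1) (β - unitIdx 1) := by
    rw [admissible_iff]; simp [unitIdx]; omega
  have A2 : Admissible α (β - unitIdx 2) := by
    rw [admissible_iff]; simp [unitIdx]; omega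
  have A2' : Admissible (α - unitIdx 0 + unitIdx 2) (β - unitIdx 2) := by
    rw [admissible_iff]; simp [unitIdx]; omega
  have A3 : Admissible (α - unitIdx 0 + unitIdx 1 + unitIdx 2) β := by
    rw [admissible_iff]; simp [unitIdx]; omega
  obtain ⟨N1, hN1⟩ := stepN hb1 A1
  obtain ⟨N1', hN1'⟩ := stepN hb1 A1'
  obtain ⟨N2, hN2⟩ := stepN hb2 A2
  obtain ⟨N2', hN2'⟩ := stepN hb2 A2'
  obtain ⟨N3, hN3⟩ := stepK (by simp [unitIdx]; omega) A3
  refine unfoldI (N := N1 + N1' + N2 + N2' + N3) fun d hd => ?_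
  rw [if_neg hz, if_neg hb0, if_neg ha0, if_neg hs1, if_neg hs2, hN1 d (by omega),
    hN1' d (by omega), hN2 d (by omega), hN2' d (by omega), hN3 d (by omega),
    stdMean_eq_half_add_sub (by omega) hb1 hb2 A1 A1' A2 A2' A3]
  simp only [Option.bind_eq_bind, Option.bind_some, Option.pure_def, EReal.coe_sub, EReal.coe_mul,
    EReal.coe_add]

lemma computeI_of_not_admissible (s₂ : SortRule 2) (s₃ : SortRule 3) {a b : Fin 3 → ℕ}
    (h : ¬ Admissible a b) {depth : ℕ} (hd : 1 ≤ depth) :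
    computeI s₂ s₃ depth a b = some ⊤ := by
  obtain ⟨d, rfl⟩ := Nat.exists_eq_add_of_le' hd
  rw [computeI, if_pos]
  by_contra hcon
  rw [gt_iff_lt, not_lt, max_le_iff, max_le_iff] at hcon
  exact h (admissible_iff.2 hcon)

theorem mainTheorem1
    (T : AffineBasis (Fin 3) ℝ (EuclideanSpace ℝ (Fin 2)))
    (s₂ : SortRule 2) (s₃ : SortRule 3) (α β : Fin 3 → ℕ) :
    ∃ r : EReal,
      (∃ N : ℕ, ∀ depth ≥ N, computeI s₂ s₃ depth α β = some r) ∧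
      r = ((meanIntegral T α β : ℝ≥0∞) : EReal) ∧
      (r = ⊤ ↔ ¬ IntegrableOn (ratFunOn T α β) (triangleSet T) volume) := by
  rw [integrableOn_ratFunOn_iff, not_not, meanIntegral_eq]
  by_cases h : Admissible α β
  · refine ⟨_, exists_computeI_eq s₂ s₃ _ _ α β rfl rfl h, ?_, ?_⟩
    · rw [stdMean_eq_toReal, ← ENNReal.toReal_ofNat, ← ENNReal.toReal_mul,
        EReal.coe_ennreal_toReal]
      exact ENNReal.mul_ne_top (by norm_num) h.stdLint_ne_top
    · simp [h.stdLint_ne_top]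
  · have ht := stdLint_eq_top_of_not_admissible h
    refine ⟨⊤, ⟨1, fun depth hd => computeI_of_not_admissible s₂ s₃ h hd⟩, ?_, ?_⟩
    · rw [ht, ENNReal.mul_top (by norm_num), EReal.coe_ennreal_top]
    · simp [ht]
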